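/- Let $\mathcal X$ be a separable real Hilbert space and let $\mu = N(0,\mathcal K)$ be a centered Gaussian Borel probability measure on $\mathcal X$ with covariance operator $\mathcal K$ and Cameron--Martin space $\mathcal H(\mu) = \mathcal K^{1/2}\mathcal X$. Let $\phi_1,\dots,\phi_N$ be bounded linear functionals on $\mathcal X$, let $F:\mathbb R^N\to\mathbb R^M$ be Lipschitz on every ball centered at the origin, and put $G(u) = F(\phi_1(u),\dots,\phi_N(u))$. Fix $y \in G(\mathcal H(\mu))$. For $\beta>0$ let $\mu^y_\beta$ be the posterior measure on $\mathcal X$ given by $$\frac{\mathrm d\mu^y_\beta}{\mathrm d\mu}(u) = \frac{1}{\omega_\beta(y)}\exp\Bigl(-\frac{1}{2\beta^2}|G(u)-y|^2\Bigr),\qquad \omega_\beta(y)=\int_{\mathcal X} \exp\Bigl(-\frac{1}{2\beta^2}|G(u)-y|^2\Bigr)\,\mu(\mathrm du).$$ Write $B_r(u)$ for the open ball of radius $r$ around $u$ in $\mathcal X$. A MAP estimator of $\mu^y_\beta$ is a point $u^y_\beta\in\mathcal X$ with $$\lim_{r\downarrow 0}\frac{\mu^y_\beta(B_r(u^y_\beta))}{\sup_{v\in\mathcal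 X}\mu^y_\beta(B_r(v))}=1.$$ A conditional mode of $\mu^y_0=\mu(\mathrm du\mid G(u)=y)$, where $y$ has to belong to the support of $G_\sharp\mu$, is a point $u^y_0\in G^{-1}(y)$ with $$\lim_{r\downarrow 0}\frac{\mu(B_r(u^y_0))}{\sup_{v\in G^{-1}(y)}\mu(B_r(v))}=1.$$ Then for every $\beta>0$ a MAP estimator of $\mu^y_\beta$ exists. Moreover, for every sequence $(\beta_k)$ of positive numbers with $\beta_k\to0$ and every choice of MAP estimators $u^y_{\beta_k}$ of $\mu^y_{\beta_k}$, there is a subsequence $(\beta_{k_n})$ such that $u^y_{\beta_{k_n}}$ converges in $\mathcal X$ to a conditional mode $u^y_0$ of $\mu^y_0$ (in particular $y\in\operatorname{supp}G_\sharp\mu$). -/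

import Mathlib

open MeasureTheory ProbabilityTheory Filter Topology
open scoped ENNReal NNReal

namespace GaussianModes

/-- The Cameron-Martin space `K^{1/2} X` of a centered Gaussian measure with covariance operator
`K`, where `K^{1/2}` is the (unique) positive square root of `K`. For a centered measure Mathlib's
`covarianceOperator` is the usual covariance operator: `⟪K a, b⟫ = ∫ ⟪a, z⟫ * ⟪b, z⟫ ∂μ(z)`. -/
def cameronMartinSpace {X : Type*} [NormedAddCommGroup X] [InnerProductSpace ℝ X]
    [CompleteSpace X] [MeasurableSpace X] [BorelSpace X] (μ : Measure X) : Set X :=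
  {h | ∃ S : X →L[ℝ] X, S.IsPositive ∧ S ∘L S = covarianceOperator μ ∧ h ∈ Set.range S}

/-- Local Lipschitz continuity: Lipschitz on every ball centered at the origin. -/
def LipschitzOnBalls {N M : ℕ}
    (F : EuclideanSpace ℝ (Fin N) → EuclideanSpace ℝ (Fin M)) : Prop :=
  ∀ r : ℝ, 0 < r → ∃ L : ℝ≥0, LipschitzOnWith L F (Metric.ball 0 r)

/-- The forward map `G = F ∘ φ` for a vector `φ = (φ₁, …, φ_N)` of bounded linear functionals. -/
def forwardMap {X : Type*} [NormedAddCommGroup X] [InnerProductSpace ℝ X] {N M : ℕ}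
    (F : EuclideanSpace ℝ (Fin N) → EuclideanSpace ℝ (Fin M))
    (φ : Fin N → StrongDual ℝ X) (u : X) : EuclideanSpace ℝ (Fin M) :=
  F (WithLp.toLp 2 fun i => φ i u)

/-- The unnormalised likelihood `exp (-|G(u) - y|² / (2 β²))`. -/
noncomputable def likelihood {X : Type*} {M : ℕ} (G : X → EuclideanSpace ℝ (Fin M))
    (y : EuclideanSpace ℝ (Fin M)) (β : ℝ) (u : X) : ℝ :=
  Real.exp (-(1 / (2 * β ^ 2)) * ‖G u - y‖ ^ 2)

/-- The posterior measure, given through its density with respect to the prior `μ`: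
`likelihood / ω`, where `ω = ∫ likelihood ∂μ`. -/
noncomputable def posterior {X : Type*} [MeasurableSpace X] {M : ℕ} (μ : Measure X)
    (G : X → EuclideanSpace ℝ (Fin M)) (y : EuclideanSpace ℝ (Fin M)) (β : ℝ) : Measure X :=
  μ.withDensity fun u =>
    ENNReal.ofReal (likelihood G y β u / ∫ v, likelihood G y β v ∂μ)

/-- `u` is a mode of `ν`: the ratio `ν(B_r(u)) / sup_v ν(B_r(v))` tends to `1` as `r ↓ 0`.
A mode of a posterior measure is called a MAP estimator. -/
def IsMode {X : Type*} [PseudoMetricSpace X] [MeasurableSpace X] (ν : Measure X) (u : X) : Prop :=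
  Tendsto (fun r : ℝ => ν (Metric.ball u r) / ⨆ v : X, ν (Metric.ball v r)) (𝓝[>] 0) (𝓝 1)

/-- `u` is a conditional mode of `ν(du | T(u) = y)`: the point `y` is in the support of the
push-forward `T_# ν`, `T u = y`, and `ν(B_r(u)) / sup_{v ∈ T⁻¹(y)} ν(B_r(v)) → 1` as `r ↓ 0`. -/
def IsConditionalMode {X Y : Type*} [PseudoMetricSpace X] [MeasurableSpace X]
    [TopologicalSpace Y] [MeasurableSpace Y] (ν : Measure X) (T : X → Y) (y : Y) (u : X) : Prop :=
  y ∈ (ν.map T).support ∧ T u = y ∧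
    Tendsto (fun r : ℝ => ν (Metric.ball u r) / ⨆ v ∈ T ⁻¹' {y}, ν (Metric.ball v r))
      (𝓝[>] 0) (𝓝 1)

end GaussianModes

namespace GaussianModes

open scoped RealInnerProductSpace

/-! The data see only finitely many Gaussian coordinates. With `S` the square root of the covariance
`K`, `exists_orthonormal_parametrisation` gives `L` on some `ℝ^k` such that `L* K L = 1` and, almost
surely, `φ i w = φ i (K L (L* w))`. Thus `c ↦ K L c` embeds `ℝ^k` isometrically into the
Cameron-Martin space, and every potential `Φ` below depends a.s. only on `L* w`.

Small balls are compared with the ball at `0`. The Cameron-Martin formula bounds `μ(B_r(K a))` from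
below; with Anderson's inequality it also bounds `μ(B_r(v))` from above for every `v`. It follows
that the modes of `exp(-Φ) μ` are exactly the points `K L c` with `c` minimising `Φ(K L c) +
‖c‖²/2`, a coercive problem on `ℝ^k`; this gives existence.

For `β → 0`, comparing a minimiser with any `c` such that `G(K L c) = y` shows that its norm is at
most `‖c‖` and that its misfit is `O(β)`. A convergent subsequence therefore ends at a feasible
point of least norm, and such a point is a conditional mode by the same ball estimates. -/

theorem inner_covarianceOperator_comm {X : Type*} [NormedAddCommGroup X] [InnerProductSpace ℝ X]
    [CompleteSpace X] [MeasurableSpace X] [BorelSpace X] {μ : Measure X} (a b : X) :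
    ⟪covarianceOperator μ a, b⟫ = ⟪covarianceOperator μ b, a⟫ := by
  have := (isPositive_covarianceOperator (μ := μ)).1 a b
  rw [real_inner_comm a]
  exact this

/-! ### Exponential moments and the Cameron-Martin formula. -/

section CenteredGaussian

variable {X : Type*} [NormedAddCommGroup X] [InnerProductSpace ℝ X] [CompleteSpace X]
  [SecondCountableTopology X] [MeasurableSpace X] [BorelSpace X]
  {μ : Measure X} [IsGaussian μ]

theorem map_inner_eq_gaussianReal (hμ : ∫ x, x ∂μ = 0) (a : X) :
    μ.map (fun z => ⟪a, z⟫) = gaussianReal 0 ⟪covarianceOperator μ a, a⟫.toNNReal := by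
  have h := IsGaussian.map_eq_gaussianReal (μ := μ) (innerSL ℝ a)
  have h0 : ∫ z, (innerSL ℝ a) z ∂μ = 0 := by
    rw [IsGaussian.integral_dual, hμ, map_zero]
  rw [variance_of_integral_eq_zero (by fun_prop) h0, h0] at h
  rw [covarianceOperator_inner IsGaussian.memLp_two_id]
  simpa [pow_two] using h

theorem mgf_inner (hμ : ∫ x, x ∂μ = 0) (a : X) (t : ℝ) :
    mgf (fun z => ⟪a, z⟫) μ t = Real.exp (⟪covarianceOperator μ a, a⟫ * t ^ 2 / 2) := by
  rw [mgf_gaussianReal (map_inner_eq_gaussianReal hμ a)]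
  have : 0 ≤ ⟪covarianceOperator μ a, a⟫ := by
    simpa using (isPositive_covarianceOperator (μ := μ)).2 a
  simp [Real.coe_toNNReal _ this]

theorem integral_exp_inner (hμ : ∫ x, x ∂μ = 0) (a : X) :
    ∫ z, Real.exp ⟪a, z⟫ ∂μ = Real.exp (⟪covarianceOperator μ a, a⟫ / 2) := by
  simpa [mgf] using mgf_inner hμ a 1

theorem integrable_exp_inner (hμ : ∫ x, x ∂μ = 0) (a : X) :
    Integrable (fun z => Real.exp ⟪a, z⟫) μ := by
  -- A non-integrable function has integral `0` by convention, whereas the formula gives a positive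
  -- value.
  by_contra h
  have := integral_exp_inner hμ a
  rw [integral_undef h] at this
  exact (Real.exp_pos _).ne this

/-- The Cameron-Martin formula for shifts in the range of the covariance operator. -/
theorem map_add_covarianceOperator (hμ : ∫ x, x ∂μ = 0) (a : X) :
    μ.map (fun z => z + covarianceOperator μ a) = μ.tilted (fun z => ⟪a, z⟫) := by
  have hI := integrable_exp_inner hμ a
  have := isProbabilityMeasure_tilted hI
  have : IsProbabilityMeasure (μ.map (fun z => z + covarianceOperator μ a)) :=
    Measure.isProbabilityMeasure_map (by fun_prop)
  refine Measure.ext_of_charFun (funext fun t => ?_)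
  have hm : mgf (fun z => ⟪t, z⟫) (μ.map (fun z => z + covarianceOperator μ a)) =
      mgf (fun z => ⟪t, z⟫) (μ.tilted (fun z => ⟪a, z⟫)) := by
    ext s
    rw [mgf, mgf, integral_map (by fun_prop) (by fun_prop), integral_exp_tilted,
      integral_exp_inner hμ]
    have e1 : ∀ x, Real.exp (s * ⟪t, x + covarianceOperator μ a⟫) =
        Real.exp ⟪s • t, x⟫ * Real.exp (s * ⟪t, covarianceOperator μ a⟫) := fun x => by
      rw [← Real.exp_add, inner_add_right, real_inner_smul_left, mul_add]
    have e2 : ∀ x, Real.exp (((fun z => ⟪a, z⟫) + fun x => s * ⟪t, x⟫) x) =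
        Real.exp ⟪a + s • t, x⟫ := fun x => by
      simp [inner_add_left, real_inner_smul_left]
    simp_rw [e1, e2]
    rw [integral_mul_const, integral_exp_inner hμ, integral_exp_inner hμ, ← Real.exp_add,
      ← Real.exp_sub]
    congr 1
    have := inner_covarianceOperator_comm (μ := μ) a t
    simp only [map_add, map_smul, inner_add_left, inner_add_right, real_inner_smul_left,
      real_inner_smul_right, real_inner_comm (covarianceOperator μ a) t, this]
    ring
  have hset : integrableExpSet (fun z => ⟪t, z⟫) (μ.map (fun z => z + covarianceOperator μ a))
      = Set.univ := by
    ext s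
    simp only [integrableExpSet, Set.mem_ofPred_eq, Set.mem_univ, iff_true]
    rw [integrable_map_measure (by fun_prop) (by fun_prop)]
    have := (integrable_exp_inner hμ (s • t)).mul_const (Real.exp (s * ⟪t, covarianceOperator μ a⟫))
    refine this.congr (ae_of_all _ fun x => ?_)
    simp only [Function.comp]
    rw [← Real.exp_add, inner_add_right, real_inner_smul_left, mul_add]
  -- Equal real moment generating functions, finite everywhere, continue analytically to the complex
  -- plane; the value at `I` is the characteristic function.
  have hc := eqOn_complexMGF_of_mgf hm
  rw [hset] at hc
  have := hc (x := Complex.I) (by simp)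
  simp only [charFun_apply]
  simp only [complexMGF] at this
  simpa [mul_comm, real_inner_comm] using this

end CenteredGaussian

theorem measure_ball_le_of_forall_lt {X : Type*} [PseudoMetricSpace X] [MeasurableSpace X]
    {μ : Measure X} {v : X} {r : ℝ} {c : ℝ≥0∞} (h : ∀ s < r, μ (Metric.ball v s) ≤ c) :
    μ (Metric.ball v r) ≤ c := by
  have hm : Monotone fun n : ℕ => Metric.ball v (r - 1 / (n + 1)) := fun m n hmn =>
    Metric.ball_subset_ball (by have := Nat.one_div_le_one_div (α := ℝ) hmn; linarith)
  have hU : Metric.ball v r = ⋃ n : ℕ, Metric.ball v (r - 1 / (n + 1)) := by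
    refine Set.Subset.antisymm (fun z hz => ?_) (Set.iUnion_subset fun n =>
      Metric.ball_subset_ball (by have := Nat.one_div_pos_of_nat (α := ℝ) (n := n); linarith))
    obtain ⟨n, hn⟩ := exists_nat_one_div_lt (sub_pos.2 (Metric.mem_ball.1 hz))
    exact Set.mem_iUnion.2 ⟨n, Metric.mem_ball.2 (by linarith)⟩
  rw [hU, hm.measure_iUnion]
  exact iSup_le fun n => h _ (by have := Nat.one_div_pos_of_nat (α := ℝ) (n := n); linarith)

/-! ### Anderson's inequality for balls. -/

section Anderson

variable {X : Type*} [NormedAddCommGroup X] [InnerProductSpace ℝ X] [CompleteSpace X]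
  [SecondCountableTopology X] [MeasurableSpace X] [BorelSpace X]
  {μ : Measure X} [IsGaussian μ]

theorem inner_covarianceOperator_nonneg {X : Type*} [NormedAddCommGroup X] [InnerProductSpace ℝ X]
    [CompleteSpace X] [MeasurableSpace X] [BorelSpace X] {μ : Measure X} (a : X) :
    0 ≤ ⟪covarianceOperator μ a, a⟫ := by
  simpa using (isPositive_covarianceOperator (μ := μ)).2 a

theorem measure_preimage_add_covarianceOperator (hμ : ∫ x, x ∂μ = 0) (a : X) {A : Set X}
    (hA : MeasurableSet A) :
    μ ((fun z => z + covarianceOperator μ a) ⁻¹' A) =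
      ∫⁻ z in A, ENNReal.ofReal (Real.exp (⟪a, z⟫ - ⟪covarianceOperator μ a, a⟫ / 2)) ∂μ := by
  rw [← Measure.map_apply (by fun_prop) hA, map_add_covarianceOperator hμ, tilted_apply' _ _ hA,
    integral_exp_inner hμ]
  simp_rw [Real.exp_sub]

theorem measure_preimage_add_covarianceOperator_le (hμ : ∫ x, x ∂μ = 0) (a : X) {A : Set X}
    (hA : MeasurableSet A) {c : ℝ} (hc : ∀ z ∈ A, ⟪a, z⟫ ≤ c) :
    μ ((fun z => z + covarianceOperator μ a) ⁻¹' A) ≤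
      ENNReal.ofReal (Real.exp (c - ⟪covarianceOperator μ a, a⟫ / 2)) * μ A := by
  rw [measure_preimage_add_covarianceOperator hμ a hA, ← setLIntegral_const]
  refine setLIntegral_mono' hA fun z hz => ?_
  gcongr
  exact hc z hz

theorem le_measure_preimage_add_covarianceOperator (hμ : ∫ x, x ∂μ = 0) (a : X) {A : Set X}
    (hA : MeasurableSet A) {c : ℝ} (hc : ∀ z ∈ A, c ≤ ⟪a, z⟫) :
    ENNReal.ofReal (Real.exp (c - ⟪covarianceOperator μ a, a⟫ / 2)) * μ A ≤
      μ ((fun z => z + covarianceOperator μ a) ⁻¹' A) := by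
  rw [measure_preimage_add_covarianceOperator hμ a hA, ← setLIntegral_const]
  refine setLIntegral_mono' hA fun z hz => ?_
  gcongr
  exact hc z hz

theorem charFun_eq_exp_covarianceOperator (hμ : ∫ x, x ∂μ = 0) (t : X) :
    charFun μ t = Complex.exp (-(⟪covarianceOperator μ t, t⟫ / 2 : ℝ)) := by
  have h := IsGaussian.charFun_eq (μ := μ) t
  have h0 : ∫ z, ⟪t, z⟫ ∂μ = 0 := by
    have := IsGaussian.integral_dual (μ := μ) (innerSL ℝ t)
    simpa [hμ] using this
  rw [variance_of_integral_eq_zero (by fun_prop) h0, integral_complex_ofReal, h0] at h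
  rw [h, covarianceOperator_inner IsGaussian.memLp_two_id]
  simp [pow_two]

/-- The characteristic function depends only on the quadratic form of the covariance operator, which
such an isometry preserves. -/
theorem map_linearIsometryEquiv_eq_self (hμ : ∫ x, x ∂μ = 0) (σ : X ≃ₗᵢ[ℝ] X)
    (hσ : ∀ t, covarianceOperator μ (σ t) = σ (covarianceOperator μ t)) :
    μ.map σ = μ := by
  have : IsProbabilityMeasure (μ.map σ) := Measure.isProbabilityMeasure_map (by fun_prop)
  refine Measure.ext_of_charFun (funext fun t => ?_)
  have : charFun (μ.map σ) t = charFun μ (σ.symm t) := by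
    rw [charFun_apply, charFun_apply, integral_map (by fun_prop) (by fun_prop)]
    congr 1 with x
    rw [← σ.inner_map_map x, σ.apply_symm_apply]
  rw [this, charFun_eq_exp_covarianceOperator hμ, charFun_eq_exp_covarianceOperator hμ,
    ← σ.inner_map_map, ← hσ, σ.apply_symm_apply]

theorem ae_inner_eq_zero {a : X} (ha : ⟪covarianceOperator μ a, a⟫ = 0) :
    ∀ᵐ z ∂μ, ⟪a, z⟫ = 0 := by
  rw [covarianceOperator_inner IsGaussian.memLp_two_id,
    integral_eq_zero_iff_of_nonneg (fun z => mul_self_nonneg _)] at ha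
  · filter_upwards [ha] with z hz
    simpa using hz
  · exact ((IsGaussian.memLp_two_id (μ := μ)).const_inner a).integrable_mul
      ((IsGaussian.memLp_two_id (μ := μ)).const_inner a)

/-- Moving the centre of a ball towards the hyperplane orthogonal to an eigenvector of the
covariance operator increases its Gaussian measure. -/
theorem measure_ball_add_eigenvector_le (hμ : ∫ x, x ∂μ = 0) {e v : X} {l : ℝ}
    (he : covarianceOperator μ e = l • e) (hv : ⟪e, v⟫ = 0) (r : ℝ) :
    μ (Metric.ball (v + e) r) ≤ μ (Metric.ball v r) := by
  rcases eq_or_ne e 0 with rfl | he0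
  · simp
  have hen : 0 < ‖e‖ ^ 2 := by positivity
  set A := Metric.ball (v + e) r \ Metric.ball v r with hAdef
  have hA : MeasurableSet A := Metric.isOpen_ball.measurableSet.diff Metric.isOpen_ball.measurableSet
  -- Points of `A` are closer to `v + e` than to `v`, so they lie beyond the perpendicular bisector.
  have hAe : ∀ z ∈ A, ‖e‖ ^ 2 / 2 < ⟪e, z⟫ := by
    rintro z ⟨h1, h2⟩
    rw [Metric.mem_ball, dist_eq_norm] at h1 h2
    have h3 : ‖z - (v + e)‖ < ‖z - v‖ := by linarith
    have h4 := pow_lt_pow_left₀ h3 (norm_nonneg _) two_ne_zero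
    rw [← sub_sub, norm_sub_sq_real (z - v) e, inner_sub_left, real_inner_comm, real_inner_comm e v,
      hv] at h4
    linarith
  have hl : l * ‖e‖ ^ 2 = ⟪covarianceOperator μ e, e⟫ := by
    rw [he, real_inner_smul_left, real_inner_self_eq_norm_sq]
  have hl0 : 0 ≤ l := by
    have := inner_covarianceOperator_nonneg (μ := μ) e
    rw [← hl] at this
    exact nonneg_of_mul_nonneg_left this hen
  set σ : X ≃ₗᵢ[ℝ] X := (ℝ ∙ e)ᗮ.reflection with hσdef
  have hσe : σ e = -e := Submodule.reflection_orthogonalComplement_singleton_eq_neg e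
  have hσ (x : X) : σ x = x - (2 * ⟪e, x⟫ / ‖e‖ ^ 2) • e := by
    rw [hσdef, Submodule.reflection_orthogonal_apply, Submodule.reflection_singleton_apply]
    rw [neg_sub, ← Nat.cast_smul_eq_nsmul ℝ, smul_smul, mul_div_assoc]
    rfl
  have hσv : σ v = v := by simp [hσ, hv]
  have hσK (t : X) : covarianceOperator μ (σ t) = σ (covarianceOperator μ t) := by
    rw [hσ, hσ, map_sub, map_smul, he, ← real_inner_comm e (covarianceOperator μ t),
      inner_covarianceOperator_comm t e, he, real_inner_smul_left, smul_smul]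
    congr 2
    ring
  have hmap := map_linearIsometryEquiv_eq_self hμ σ hσK
  have key : μ A ≤ μ (Metric.ball v r \ Metric.ball (v + e) r) := by
    -- If `l = 0`, then `⟪e, z⟫` vanishes a.s. and `A` is null. Otherwise `e` is the admissible
    -- shift `K (l⁻¹ • e)`, whose density is at least `1` on `A`.
    rcases hl0.eq_or_lt with rfl | hlpos
    · have hz := ae_inner_eq_zero (μ := μ) (a := e) (by rw [← hl, zero_mul])
      have : μ A = 0 := measure_mono_null (fun z hzA => by
        have := hAe z hzA
        exact (by linarith : 0 < ⟪e, z⟫).ne') (ae_iff.1 hz)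
      simp [this]
    · have hK : covarianceOperator μ (l⁻¹ • e) = e := by
        rw [map_smul, he, smul_smul, inv_mul_cancel₀ hlpos.ne', one_smul]
      have h1 := le_measure_preimage_add_covarianceOperator hμ (l⁻¹ • e) hA
        (c := ⟪covarianceOperator μ (l⁻¹ • e), l⁻¹ • e⟫ / 2) (fun z hz => by
          rw [hK, real_inner_smul_right, real_inner_smul_left, real_inner_self_eq_norm_sq,
            mul_div_assoc]
          have := (hAe z hz).le
          gcongr)
      rw [sub_self, Real.exp_zero, ENNReal.ofReal_one, one_mul, hK] at h1
      refine h1.trans (le_of_eq ?_)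
      -- The map `z ↦ σ z + e` is the reflection in the bisector of `v` and `v + e`, so it exchanges
      -- the two balls.
      have hpre : (fun z => σ z + e) ⁻¹' A = Metric.ball v r \ Metric.ball (v + e) r := by
        ext z
        have d1 : ‖σ z + e - (v + e)‖ = ‖z - v‖ := by
          rw [add_sub_add_right_eq_sub, ← hσv, ← map_sub, σ.norm_map, hσv]
        have d2 : ‖σ z + e - v‖ = ‖z - (v + e)‖ := by
          rw [← σ.norm_map (z - (v + e)), map_sub, map_add, hσe, hσv]
          congr 1
          abel
        simp only [hAdef, Set.mem_preimage, Set.mem_sdiff, Metric.mem_ball, dist_eq_norm, d1, d2]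
      rw [← hpre]
      conv_lhs => rw [← hmap, Measure.map_apply (by fun_prop) (hA.preimage (by fun_prop))]
      rfl
  calc μ (Metric.ball (v + e) r)
      = μ (Metric.ball (v + e) r ∩ Metric.ball v r) + μ A :=
        (measure_inter_add_sdiff _ Metric.isOpen_ball.measurableSet).symm
    _ ≤ μ (Metric.ball v r ∩ Metric.ball (v + e) r) + μ (Metric.ball v r \ Metric.ball (v + e) r) := by
        rw [Set.inter_comm]; gcongr
    _ = μ (Metric.ball v r) := measure_inter_add_sdiff _ Metric.isOpen_ball.measurableSet

/-- The operator is the Bochner integral of the rank-one operators `z ⊗ z`, and compact operators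
form a closed convex set. Compactness makes the span of the eigenvectors dense. -/
theorem isCompactOperator_covarianceOperator : IsCompactOperator (covarianceOperator μ) := by
  have hint : Integrable (fun z : X => InnerProductSpace.rankOne ℝ z z) μ := by
    refine Integrable.mono' ((IsGaussian.memLp_two_id (μ := μ)).integrable_norm_pow two_ne_zero)
      (Continuous.aestronglyMeasurable (((InnerProductSpace.rankOne ℝ).continuous.comp
        continuous_id).clm_apply continuous_id)) (ae_of_all _ fun z => ?_)
    simp [pow_two]
  have hK : ∫ z, InnerProductSpace.rankOne ℝ z z ∂μ = covarianceOperator μ := by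
    ext x
    rw [ContinuousLinearMap.integral_apply hint,
      covarianceOperator_apply IsGaussian.memLp_two_id]
    simp [real_inner_comm]
  rw [← hK]
  have := (compactOperator (RingHom.id ℝ) X X).convex.integral_mem (μ := μ)
    isClosed_setOfPred_isCompactOperator (ae_of_all _ fun z => ?_) hint
  · exact this
  · exact (isCompactOperator_of_locallyCompactSpace_dom (innerSL ℝ z)).clm_comp
      (ContinuousLinearMap.toSpanSingleton ℝ z)

/-- Eigencomponents of the centre are removed one at a time; each is orthogonal to those that
remain. -/
theorem measure_ball_le_of_mem_iSup_eigenspace (hμ : ∫ x, x ∂μ = 0) {w : X}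
    (hw : w ∈ ⨆ l, Module.End.eigenspace (covarianceOperator μ : Module.End ℝ X) l) (r : ℝ) :
    μ (Metric.ball w r) ≤ μ (Metric.ball 0 r) := by
  classical
  obtain ⟨f, hf, rfl⟩ := (Submodule.mem_iSup_iff_exists_finsupp _ _).1 hw
  have hs : (covarianceOperator μ : Module.End ℝ X).IsSymmetric :=
    (isPositive_covarianceOperator (μ := μ)).1
  rw [Finsupp.sum]
  induction f.support using Finset.induction_on with
  | empty => simp
  | insert i s hi ih =>
    rw [Finset.sum_insert hi, add_comm]
    refine (measure_ball_add_eigenvector_le hμ (Module.End.mem_eigenspace_iff.1 (hf i)) ?_ r).trans ih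
    rw [inner_sum]
    refine Finset.sum_eq_zero fun j hj => ?_
    have hij : i ≠ j := fun h => hi (h ▸ hj)
    exact hs.orthogonalFamily_eigenspaces hij ⟨_, hf i⟩ ⟨_, hf j⟩

/-- Anderson's inequality for balls: among the balls of a given radius, the one centred at the mean
has the largest Gaussian measure. -/
theorem measure_ball_le_measure_ball_zero (hμ : ∫ x, x ∂μ = 0) (v : X) (r : ℝ) :
    μ (Metric.ball v r) ≤ μ (Metric.ball 0 r) := by
  have hs : (covarianceOperator μ : Module.End ℝ X).IsSymmetric :=
    (isPositive_covarianceOperator (μ := μ)).1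
  have hd := ContinuousLinearMap.orthogonalComplement_iSup_eigenspaces_eq_bot
    (isCompactOperator_covarianceOperator (μ := μ)) hs
  rw [← Submodule.topologicalClosure_eq_top_iff, ← Submodule.dense_iff_topologicalClosure_eq_top]
    at hd
  have hlt (s : ℝ) (hsr : s < r) : μ (Metric.ball v s) ≤ μ (Metric.ball 0 r) := by
    obtain ⟨w, hw, hwv⟩ := hd.exists_dist_lt v (sub_pos.2 hsr)
    exact (measure_mono (Metric.ball_subset_ball' (by linarith))).trans
      (measure_ball_le_of_mem_iSup_eigenspace hμ hw r)
  exact measure_ball_le_of_forall_lt hlt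

end Anderson

/-! ### Small-ball estimates relative to the centred ball. -/

section SmallBalls

variable {X : Type*} [NormedAddCommGroup X] [InnerProductSpace ℝ X] [CompleteSpace X]
  [SecondCountableTopology X] [MeasurableSpace X] [BorelSpace X]
  {μ : Measure X} [IsGaussian μ]

/-- A shift by `-K a` produces the exponential factor, and Anderson's inequality recentres the
shifted ball at `0`. The free `a` is a dual variable, to be optimised for each use. -/
theorem measure_ball_le_exp_mul (hμ : ∫ x, x ∂μ = 0) (a v : X) (r : ℝ) :
    μ (Metric.ball v r) ≤
      ENNReal.ofReal (Real.exp (⟪covarianceOperator μ a, a⟫ / 2 - ⟪a, v⟫ + r * ‖a‖)) *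
        μ (Metric.ball 0 r) := by
  have hpre : Metric.ball v r =
      (fun z => z + covarianceOperator μ (-a)) ⁻¹' Metric.ball (v + covarianceOperator μ (-a)) r := by
    ext z
    simp
  have h := measure_preimage_add_covarianceOperator_le hμ (-a)
    (A := Metric.ball (v + covarianceOperator μ (-a)) r) Metric.isOpen_ball.measurableSet
    (c := ⟪covarianceOperator μ a, a⟫ - ⟪a, v⟫ + r * ‖a‖) (fun z hz => by
      have h1 : ⟪-a, z - (v + covarianceOperator μ (-a))⟫ ≤ r * ‖a‖ := by
        refine (real_inner_le_norm _ _).trans ?_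
        rw [norm_neg, mul_comm]
        gcongr
        exact (mem_ball_iff_norm.1 hz).le
      have h2 : ⟪-a, v + covarianceOperator μ (-a)⟫ = ⟪covarianceOperator μ a, a⟫ - ⟪a, v⟫ := by
        rw [map_neg, inner_add_right, inner_neg_neg, inner_neg_left, real_inner_comm a]
        ring
      rw [inner_sub_right] at h1
      linarith)
  rw [← hpre] at h
  refine h.trans (mul_le_mul' (le_of_eq ?_) (measure_ball_le_measure_ball_zero hμ _ r))
  congr 2
  rw [map_neg, inner_neg_neg]
  ring

theorem exp_mul_measure_ball_zero_le (hμ : ∫ x, x ∂μ = 0) (a : X) (r : ℝ) :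
    ENNReal.ofReal (Real.exp (-⟪covarianceOperator μ a, a⟫ / 2 - r * ‖a‖)) *
        μ (Metric.ball 0 r) ≤ μ (Metric.ball (covarianceOperator μ a) r) := by
  have hpre : Metric.ball (covarianceOperator μ a) r =
      (fun z => z + covarianceOperator μ (-a)) ⁻¹' Metric.ball 0 r := by
    ext z
    simp [dist_eq_norm, sub_eq_add_neg]
  have h := le_measure_preimage_add_covarianceOperator hμ (-a)
    (A := Metric.ball 0 r) Metric.isOpen_ball.measurableSet (c := -(r * ‖a‖)) (fun z hz => by
      rw [inner_neg_left, neg_le_neg_iff]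
      refine (real_inner_le_norm _ _).trans ?_
      rw [mul_comm]
      gcongr
      exact (mem_ball_zero_iff.1 hz).le)
  rw [← hpre] at h
  refine le_trans (le_of_eq ?_) h
  congr 3
  rw [map_neg, inner_neg_neg]
  ring

/-- By Anderson's inequality, if this ball were null then all balls of radius `r` would be, making
`μ` locally null. -/
theorem measure_ball_zero_pos (hμ : ∫ x, x ∂μ = 0) {r : ℝ} (hr : 0 < r) :
    0 < μ (Metric.ball 0 r) := by
  refine pos_iff_ne_zero.2 fun h0 => ?_
  have : μ Set.univ = 0 := measure_null_of_locally_null _ fun x _ =>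
    ⟨Metric.ball x r, mem_nhdsWithin_of_mem_nhds (Metric.ball_mem_nhds x hr),
      le_antisymm (h0 ▸ measure_ball_le_measure_ball_zero hμ x r) zero_le⟩
  simp at this

/-- Two continuous functions that agree almost everywhere agree at every point of the support. -/
theorem eq_of_ae_eq_of_measure_ball_ne_zero {X Y : Type*} [PseudoMetricSpace X] [MeasurableSpace X]
    [TopologicalSpace Y] [T2Space Y] {μ : Measure X} {f g : X → Y} (hf : Continuous f)
    (hg : Continuous g) (h : f =ᵐ[μ] g) {u : X} (hu : ∀ r > 0, μ (Metric.ball u r) ≠ 0) :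
    f u = g u := by
  by_contra hne
  obtain ⟨r, hr, hsub⟩ := Metric.isOpen_iff.1 (isOpen_ne_fun hf hg) u hne
  exact hu r hr (measure_mono_null hsub (ae_iff.1 h))

theorem tendsto_div_nhds_one {f g : ℝ → ℝ≥0∞} {l : Filter ℝ} (hfg : ∀ᶠ r in l, f r ≤ g r)
    (hg0 : ∀ᶠ r in l, g r ≠ 0) (hg : ∀ᶠ r in l, g r ≠ ∞)
    (h : ∀ η > 0, ∀ᶠ r in l, g r ≤ ENNReal.ofReal (Real.exp η) * f r) :
    Tendsto (fun r => f r / g r) l (𝓝 1) := by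
  refine tendsto_order.2 ⟨fun a ha => ?_, fun a ha => ?_⟩
  · have hc : Tendsto (fun η : ℝ => ENNReal.ofReal (Real.exp (-η))) (𝓝[>] 0) (𝓝 1) := by
      have : Continuous fun η : ℝ => ENNReal.ofReal (Real.exp (-η)) :=
        ENNReal.continuous_ofReal.comp (by fun_prop)
      simpa using (this.tendsto 0).mono_left nhdsWithin_le_nhds
    obtain ⟨η, hη, hη0⟩ := ((hc.eventually (lt_mem_nhds ha)).and self_mem_nhdsWithin).exists
    filter_upwards [h η hη0, hg0, hg] with r h1 h2 h3
    refine hη.trans_le ((ENNReal.le_div_iff_mul_le (Or.inl h2) (Or.inl h3)).2 ?_)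
    calc _ ≤ ENNReal.ofReal (Real.exp (-η)) * (ENNReal.ofReal (Real.exp η) * f r) := by gcongr
      _ = f r := by
        rw [← mul_assoc, ← ENNReal.ofReal_mul (Real.exp_pos _).le, ← Real.exp_add]
        simp
  · filter_upwards [hfg] with r h1
    exact (ENNReal.div_le_of_le_mul (by simpa using h1)).trans_lt ha

/-- If `L` is orthonormal for the covariance form, the measure of a ball is bounded in terms of the
coordinates along `L` of any of its points. -/
theorem measure_ball_le_of_mem_ball {H : Type*} [NormedAddCommGroup H] [InnerProductSpace ℝ H]
    [CompleteSpace H] (hμ : ∫ x, x ∂μ = 0) {L : H →L[ℝ] X}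
    (hL : ∀ c, L.adjoint (covarianceOperator μ (L c)) = c) {v w : X} {r : ℝ}
    (hw : w ∈ Metric.ball v r) :
    μ (Metric.ball v r) ≤
      ENNReal.ofReal (Real.exp (-‖L.adjoint w‖ ^ 2 / 2 + 2 * r * ‖L‖ * ‖L.adjoint w‖)) *
        μ (Metric.ball 0 r) := by
  -- For `a = L (L* w)` both `⟪K a, a⟫` and `⟪a, w⟫` equal `‖L* w‖²`. Replacing the centre `v` by
  -- `w` costs a second `r * ‖a‖`, hence the factor `2`.
  refine (measure_ball_le_exp_mul hμ (L (L.adjoint w)) v r).trans ?_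
  have hr : 0 < r := dist_nonneg.trans_lt (Metric.mem_ball.1 hw)
  have h1 : ⟪covarianceOperator μ (L (L.adjoint w)), L (L.adjoint w)⟫ = ‖L.adjoint w‖ ^ 2 := by
    rw [← ContinuousLinearMap.adjoint_inner_left, hL, real_inner_self_eq_norm_sq]
  have h2 : ⟪L (L.adjoint w), w⟫ = ‖L.adjoint w‖ ^ 2 := by
    rw [← ContinuousLinearMap.adjoint_inner_right, real_inner_self_eq_norm_sq]
  have h3 : ⟪L (L.adjoint w), w - v⟫ ≤ r * ‖L (L.adjoint w)‖ := by
    refine (real_inner_le_norm _ _).trans ?_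
    rw [mul_comm]
    gcongr
    exact (mem_ball_iff_norm.1 hw).le
  have h4 : r * ‖L (L.adjoint w)‖ ≤ r * (‖L‖ * ‖L.adjoint w‖) := by
    gcongr
    exact L.le_opNorm _
  rw [inner_sub_right] at h3
  refine mul_le_mul_left (ENNReal.ofReal_le_ofReal (Real.exp_le_exp.2 ?_)) _
  rw [h1]
  linarith

end SmallBalls

/-! ### Modes of tilted measures and the Onsager-Machlup functional. -/

section Tilted

variable {X : Type*} [NormedAddCommGroup X] [InnerProductSpace ℝ X] [CompleteSpace X]
  [SecondCountableTopology X] [MeasurableSpace X] [BorelSpace X] {μ : Measure X}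

theorem integrable_exp_neg {X : Type*} [TopologicalSpace X] [MeasurableSpace X] [BorelSpace X]
    {μ : Measure X} [IsFiniteMeasure μ] {Φ : X → ℝ} (hΦ : Continuous Φ) (hΦ0 : ∀ u, 0 ≤ Φ u) :
    Integrable (fun u => Real.exp (-Φ u)) μ := by
  refine Integrable.of_bound (C := 1) (Measurable.aestronglyMeasurable
    (hΦ.measurable.neg.exp)) (ae_of_all _ fun u => ?_)
  simpa [abs_of_pos (Real.exp_pos _)] using hΦ0 u

theorem ofReal_integral_mul_tilted_apply {X : Type*} [MeasurableSpace X]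
    {μ : Measure X} [NeZero μ] {f : X → ℝ} (hf : Integrable (fun u => Real.exp (f u)) μ)
    {A : Set X} (hA : MeasurableSet A) :
    ENNReal.ofReal (∫ u, Real.exp (f u) ∂μ) * μ.tilted f A =
      ∫⁻ u in A, ENNReal.ofReal (Real.exp (f u)) ∂μ := by
  have hω : 0 < ∫ u, Real.exp (f u) ∂μ := integral_exp_pos hf
  rw [tilted_apply' _ _ hA, ← lintegral_const_mul' _ _ ENNReal.ofReal_ne_top]
  refine lintegral_congr fun u => ?_
  rw [← ENNReal.ofReal_mul hω.le, mul_div_cancel₀ _ hω.ne']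

theorem eventually_exp_mul_measure_ball_le {X : Type*} [PseudoMetricSpace X] [MeasurableSpace X]
    [OpensMeasurableSpace X] {μ : Measure X} {Φ : X → ℝ} (hΦ : Continuous Φ) (u : X) {η : ℝ}
    (hη : 0 < η) : ∀ᶠ r in 𝓝[>] 0,
      ENNReal.ofReal (Real.exp (-Φ u - η)) * μ (Metric.ball u r) ≤
        ∫⁻ z in Metric.ball u r, ENNReal.ofReal (Real.exp (-Φ z)) ∂μ ∧
      ∫⁻ z in Metric.ball u r, ENNReal.ofReal (Real.exp (-Φ z)) ∂μ ≤
        ENNReal.ofReal (Real.exp (-Φ u + η)) * μ (Metric.ball u r) := by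
  obtain ⟨δ, hδ, h⟩ := Metric.continuous_iff.1 hΦ u η hη
  filter_upwards [Ioo_mem_nhdsGT hδ] with r hr
  have hz (z : X) (hz : z ∈ Metric.ball u r) : |Φ z - Φ u| < η :=
    h z ((Metric.mem_ball.1 hz).trans hr.2)
  rw [← setLIntegral_const, ← setLIntegral_const]
  constructor <;> refine setLIntegral_mono' Metric.isOpen_ball.measurableSet fun z hzr => ?_ <;>
    gcongr <;> linarith [abs_lt.1 (hz z hzr)]

theorem eq_zero_of_forall_mul_norm_sq_sub_le {X : Type*} [NormedAddCommGroup X] [InnerProductSpace ℝ X]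
    {d : X} {q : ℝ} (hq : 0 ≤ q) (h : ∀ t : ℝ, t * ‖d‖ ^ 2 - t ^ 2 * q / 2 ≤ 0) : d = 0 := by
  have h2 : 0 < q + 1 := by linarith
  -- The quadratic is maximal at `‖d‖² / q`; the `+ 1` covers `q = 0`.
  have h1 := h (‖d‖ ^ 2 / (q + 1))
  have h3 : ‖d‖ ^ 2 / (q + 1) * ‖d‖ ^ 2 - (‖d‖ ^ 2 / (q + 1)) ^ 2 * q / 2 =
      (‖d‖ ^ 2) ^ 2 * (q + 2) / (2 * (q + 1) ^ 2) := by
    field_simp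
    ring
  rw [h3] at h1
  by_contra hd
  have : 0 < ‖d‖ := norm_pos_iff.2 hd
  exact h1.not_gt (by positivity)

variable [IsGaussian μ] {H : Type*} [NormedAddCommGroup H] [InnerProductSpace ℝ H]
    [CompleteSpace H] {L : H →L[ℝ] X} {Φ : X → ℝ}

/-- The bound must be uniform in `v`, so continuity of `Φ` at the centre is of no use. Instead, for
almost every `w` in the ball, the ball's measure is estimated through the coordinates of that same
`w`, so that `Φ w` and `‖L* w‖²/2` combine to at least `m`. -/
theorem setLIntegral_ball_exp_neg_le (hμ : ∫ x, x ∂μ = 0)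
    (hL : ∀ c, L.adjoint (covarianceOperator μ (L c)) = c)
    (hΦL : ∀ᵐ w ∂μ, Φ w = Φ (covarianceOperator μ (L (L.adjoint w)))) {m : ℝ}
    (hm : ∀ c, m ≤ Φ (covarianceOperator μ (L c)) + ‖c‖ ^ 2 / 2) (hΦ0 : ∀ u, 0 ≤ Φ u)
    {r : ℝ} (hr0 : 0 < r) (hr1 : r < 1) (v : X) :
    ∫⁻ z in Metric.ball v r, ENNReal.ofReal (Real.exp (-Φ z)) ∂μ ≤
      ENNReal.ofReal (Real.exp (-((1 - r) * m) + 2 * r * ‖L‖ ^ 2)) * μ (Metric.ball 0 r) := by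
  rcases eq_or_ne (μ (Metric.ball v r)) 0 with h0 | h0
  · rw [setLIntegral_measure_zero _ _ h0]
    exact zero_le
  have hfin : μ (Metric.ball v r) ≠ ∞ := measure_ne_top _ _
  set B := ENNReal.ofReal (Real.exp (-((1 - r) * m) + 2 * r * ‖L‖ ^ 2)) * μ (Metric.ball 0 r)
    with hB
  calc ∫⁻ z in Metric.ball v r, ENNReal.ofReal (Real.exp (-Φ z)) ∂μ
      ≤ ∫⁻ z in Metric.ball v r, B / μ (Metric.ball v r) ∂μ := by
        refine setLIntegral_mono_ae' Metric.isOpen_ball.measurableSet ?_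
        filter_upwards [hΦL] with w hw hwv
        rw [ENNReal.le_div_iff_mul_le (Or.inl h0) (Or.inl hfin)]
        calc _ ≤ ENNReal.ofReal (Real.exp (-Φ w)) * (ENNReal.ofReal (Real.exp
              (-‖L.adjoint w‖ ^ 2 / 2 + 2 * r * ‖L‖ * ‖L.adjoint w‖)) * μ (Metric.ball 0 r)) := by
              gcongr
              exact measure_ball_le_of_mem_ball hμ hL hwv
          _ ≤ B := by
              rw [← mul_assoc, ← ENNReal.ofReal_mul (Real.exp_pos _).le, ← Real.exp_add, hB]
              refine mul_le_mul_left (ENNReal.ofReal_le_ofReal (Real.exp_le_exp.2 ?_)) _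
              have h1 := hm (L.adjoint w)
              rw [← hw] at h1
              have h2 := hΦ0 w
              -- The cross term `2r‖L‖‖L* w‖` is absorbed into `r‖L* w‖²/2 + 2r‖L‖²`, which leaves
              -- the factor `1 - r`.
              nlinarith [mul_le_mul_of_nonneg_left h1 (by linarith : 0 ≤ 1 - r),
                mul_nonneg hr0.le (sq_nonneg (‖L.adjoint w‖ - 2 * ‖L‖)), mul_nonneg hr0.le h2]
    _ = B := by
        rw [setLIntegral_const, ENNReal.div_mul_cancel h0 hfin]

/-- Minimisers of the Onsager-Machlup functional are modes of the tilted measure. -/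
theorem isMode_tilted_of_forall_le (hμ : ∫ x, x ∂μ = 0)
    (hL : ∀ c, L.adjoint (covarianceOperator μ (L c)) = c)
    (hΦL : ∀ᵐ w ∂μ, Φ w = Φ (covarianceOperator μ (L (L.adjoint w))))
    (hΦ : Continuous Φ) (hΦ0 : ∀ u, 0 ≤ Φ u) {c₀ : H}
    (hm : ∀ c, Φ (covarianceOperator μ (L c₀)) + ‖c₀‖ ^ 2 / 2 ≤
      Φ (covarianceOperator μ (L c)) + ‖c‖ ^ 2 / 2) :
    IsMode (μ.tilted fun u => -Φ u) (covarianceOperator μ (L c₀)) := by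
  have hint := integrable_exp_neg (μ := μ) hΦ hΦ0
  have := isProbabilityMeasure_tilted hint
  have hω : 0 < ∫ u, Real.exp (-Φ u) ∂μ := integral_exp_pos hint
  set m := Φ (covarianceOperator μ (L c₀)) + ‖c₀‖ ^ 2 / 2 with hmdef
  set u₀ := covarianceOperator μ (L c₀) with hu₀
  have hq : ⟪covarianceOperator μ (L c₀), L c₀⟫ = ‖c₀‖ ^ 2 := by
    rw [← ContinuousLinearMap.adjoint_inner_left, hL, real_inner_self_eq_norm_sq]
  have hlow := fun r => exp_mul_measure_ball_zero_le hμ (L c₀) r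
  have hpos : ∀ r > 0, 0 < (μ.tilted fun u => -Φ u) (Metric.ball u₀ r) := fun r hr => by
    refine pos_iff_ne_zero.2 fun h0 => ?_
    have h1 := absolutelyContinuous_tilted hint h0
    have h2 := hlow r
    rw [← hu₀, h1, nonpos_iff_eq_zero, mul_eq_zero] at h2
    rcases h2 with h2 | h2
    · exact (ENNReal.ofReal_pos.2 (Real.exp_pos _)).ne' h2
    · exact (measure_ball_zero_pos hμ hr).ne' h2
  refine tendsto_div_nhds_one (Eventually.of_forall fun r => le_iSup (fun v =>
    (μ.tilted fun u => -Φ u) (Metric.ball v r)) u₀) ?_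
    (Eventually.of_forall fun r => ((iSup_le fun v => prob_le_one).trans_lt ENNReal.one_lt_top).ne)
    fun η hη => ?_
  · filter_upwards [self_mem_nhdsWithin] with r hr
    exact ((hpos r hr).trans_le (le_iSup (fun v =>
      (μ.tilted fun u => -Φ u) (Metric.ball v r)) u₀)).ne'
  have hsmall : ∀ᶠ r : ℝ in 𝓝[>] 0, r * (m + 2 * ‖L‖ ^ 2 + ‖L c₀‖) < η / 2 := by
    have : Continuous fun r : ℝ => r * (m + 2 * ‖L‖ ^ 2 + ‖L c₀‖) := by fun_prop
    have := (this.tendsto 0).mono_left (nhdsWithin_le_nhds (s := Set.Ioi 0))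
    rw [zero_mul] at this
    exact this.eventually (gt_mem_nhds (half_pos hη))
  filter_upwards [hsmall, Ioo_mem_nhdsGT (zero_lt_one' ℝ),
    eventually_exp_mul_measure_ball_le (μ := μ) hΦ u₀ (half_pos hη)] with r h1 h2 h3
  refine iSup_le fun v => ?_
  have h4 := ENNReal.ofReal_pos.2 hω
  rw [← ENNReal.mul_le_mul_iff_right h4.ne' ENNReal.ofReal_ne_top, mul_left_comm,
    ofReal_integral_mul_tilted_apply hint Metric.isOpen_ball.measurableSet,
    ofReal_integral_mul_tilted_apply hint Metric.isOpen_ball.measurableSet]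
  refine (setLIntegral_ball_exp_neg_le hμ hL hΦL hm hΦ0 h2.1 h2.2 v).trans ?_
  calc _ ≤ ENNReal.ofReal (Real.exp η) * (ENNReal.ofReal (Real.exp (-Φ u₀ - η / 2)) *
      (ENNReal.ofReal (Real.exp (-⟪u₀, L c₀⟫ / 2 - r * ‖L c₀‖)) * μ (Metric.ball 0 r))) := by
        rw [← mul_assoc, ← mul_assoc, ← ENNReal.ofReal_mul (Real.exp_pos _).le, ← Real.exp_add,
          ← ENNReal.ofReal_mul (Real.exp_pos _).le, ← Real.exp_add]
        refine mul_le_mul_left (ENNReal.ofReal_le_ofReal (Real.exp_le_exp.2 ?_)) _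
        rw [hq]
        linarith
    _ ≤ _ := by
        gcongr
        exact (mul_le_mul_right (hlow r) _).trans h3.1

/-- Modes of the tilted measure are minimisers of the Onsager-Machlup functional. -/
theorem eq_and_forall_le_of_isMode_tilted (hμ : ∫ x, x ∂μ = 0)
    (hL : ∀ c, L.adjoint (covarianceOperator μ (L c)) = c)
    (hΦL : ∀ᵐ w ∂μ, Φ w = Φ (covarianceOperator μ (L (L.adjoint w))))
    (hΦ : Continuous Φ) (hΦ0 : ∀ u, 0 ≤ Φ u) {u : X} (hu : IsMode (μ.tilted fun u => -Φ u) u) :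
    u = covarianceOperator μ (L (L.adjoint u)) ∧ ∀ c,
      Φ (covarianceOperator μ (L (L.adjoint u))) + ‖L.adjoint u‖ ^ 2 / 2 ≤
        Φ (covarianceOperator μ (L c)) + ‖c‖ ^ 2 / 2 := by
  have hint := integrable_exp_neg (μ := μ) hΦ hΦ0
  have := isProbabilityMeasure_tilted hint
  have hω : 0 < ∫ u, Real.exp (-Φ u) ∂μ := integral_exp_pos hint
  have hω' := ENNReal.ofReal_pos.2 hω
  have hq (c : H) : ⟪covarianceOperator μ (L c), L c⟫ = ‖c‖ ^ 2 := by
    rw [← ContinuousLinearMap.adjoint_inner_left, hL, real_inner_self_eq_norm_sq]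
  have hcmp (v : X) {η : ℝ} (hη : 0 < η) : ∀ᶠ r in 𝓝[>] 0,
      ENNReal.ofReal (Real.exp (-η)) *
        ∫⁻ z in Metric.ball v r, ENNReal.ofReal (Real.exp (-Φ z)) ∂μ ≤
      ∫⁻ z in Metric.ball u r, ENNReal.ofReal (Real.exp (-Φ z)) ∂μ := by
    have h1 : ENNReal.ofReal (Real.exp (-η)) < 1 := by
      rw [ENNReal.ofReal_lt_one, Real.exp_lt_one_iff]
      linarith
    filter_upwards [hu.eventually (lt_mem_nhds h1)] with r hr
    rw [← ofReal_integral_mul_tilted_apply hint Metric.isOpen_ball.measurableSet,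
      ← ofReal_integral_mul_tilted_apply hint Metric.isOpen_ball.measurableSet, mul_left_comm]
    gcongr
    calc _ ≤ ENNReal.ofReal (Real.exp (-η)) *
          ⨆ v, (μ.tilted fun u => -Φ u) (Metric.ball v r) := by
          gcongr
          exact le_iSup (fun v => (μ.tilted fun u => -Φ u) (Metric.ball v r)) v
      _ ≤ _ := ENNReal.mul_le_of_le_div hr.le
  have hmain (c : H) {η : ℝ} (hη : 0 < η) : ∀ᶠ r in 𝓝[>] 0,
      ENNReal.ofReal (Real.exp (-Φ (covarianceOperator μ (L c)) - ‖c‖ ^ 2 / 2 - 3 * η)) *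
        μ (Metric.ball 0 r) ≤
      ENNReal.ofReal (Real.exp (-Φ u + η)) * μ (Metric.ball u r) := by
    have hsmall : ∀ᶠ r : ℝ in 𝓝[>] 0, r * ‖L c‖ < η := by
      have : Continuous fun r : ℝ => r * ‖L c‖ := by fun_prop
      have := (this.tendsto 0).mono_left (nhdsWithin_le_nhds (s := Set.Ioi 0))
      rw [zero_mul] at this
      exact this.eventually (gt_mem_nhds hη)
    filter_upwards [hsmall, hcmp (covarianceOperator μ (L c)) hη,
      eventually_exp_mul_measure_ball_le (μ := μ) hΦ u hη,
      eventually_exp_mul_measure_ball_le (μ := μ) hΦ (covarianceOperator μ (L c)) hη]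
      with r h1 h2 h3 h4
    refine le_trans ?_ (h2.trans h3.2)
    refine le_trans ?_ (mul_le_mul_right ((mul_le_mul_right
      (exp_mul_measure_ball_zero_le hμ (L c) r) _).trans h4.1) _)
    rw [← mul_assoc, ← mul_assoc, ← ENNReal.ofReal_mul (Real.exp_pos _).le, ← Real.exp_add,
          ← ENNReal.ofReal_mul (Real.exp_pos _).le, ← Real.exp_add]
    refine mul_le_mul_left (ENNReal.ofReal_le_ofReal (Real.exp_le_exp.2 ?_)) _
    rw [hq]
    linarith
  have hball : ∀ r > 0, μ (Metric.ball u r) ≠ 0 := fun r hr h0 => by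
    obtain ⟨s, hs, hs0⟩ := ((hmain 0 one_pos).and (Ioo_mem_nhdsGT hr)).exists
    rw [measure_mono_null (Metric.ball_subset_ball hs0.2.le) h0, mul_zero, nonpos_iff_eq_zero,
      mul_eq_zero] at hs
    rcases hs with h2 | h2
    · exact (ENNReal.ofReal_pos.2 (Real.exp_pos _)).ne' h2
    · exact (measure_ball_zero_pos hμ hs0.1).ne' h2
  -- A mode lies in the support of `μ`, so the a.e. identity holds at `u` itself.
  have hΦu : Φ u = Φ (covarianceOperator μ (L (L.adjoint u))) :=
    eq_of_ae_eq_of_measure_ball_ne_zero hΦ (hΦ.comp (by fun_prop)) hΦL hball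
  -- This is minimality with half the squared Cameron-Martin norm of `u` in dual form, so `u` need
  -- not be known to lie in that space.
  have hineq (a : X) (c : H) : Φ u + ⟪a, u⟫ - ⟪covarianceOperator μ a, a⟫ / 2 ≤
      Φ (covarianceOperator μ (L c)) + ‖c‖ ^ 2 / 2 := by
    refine le_of_forall_pos_le_add fun ε hε => ?_
    have hη : 0 < ε / 5 := by positivity
    have hsmall : ∀ᶠ r : ℝ in 𝓝[>] 0, r * ‖a‖ < ε / 5 := by
      have : Continuous fun r : ℝ => r * ‖a‖ := by fun_prop
      have := (this.tendsto 0).mono_left (nhdsWithin_le_nhds (s := Set.Ioi 0))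
      rw [zero_mul] at this
      exact this.eventually (gt_mem_nhds hη)
    obtain ⟨r, ⟨h1, h2⟩, h3⟩ :=
      ((hsmall.and (hmain c hη)).and self_mem_nhdsWithin).exists
    have h4 := h2.trans (mul_le_mul_right (measure_ball_le_exp_mul hμ a u r) _)
    rw [← mul_assoc, ← ENNReal.ofReal_mul (Real.exp_pos _).le, ← Real.exp_add,
      ENNReal.mul_le_mul_iff_left (measure_ball_zero_pos hμ h3).ne' (measure_ne_top _ _),
      ENNReal.ofReal_le_ofReal_iff (Real.exp_pos _).le, Real.exp_le_exp] at h4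
    linarith
  have hinner (a : X) : ⟪L (L.adjoint u), a⟫ = ⟪L.adjoint u, L.adjoint a⟫ :=
    (ContinuousLinearMap.adjoint_inner_right _ _ _).symm
  refine ⟨sub_eq_zero.1 (eq_zero_of_forall_mul_norm_sq_sub_le (inner_covarianceOperator_nonneg (μ := μ)
    (u - covarianceOperator μ (L (L.adjoint u)))) fun t => ?_), fun c => ?_⟩
  · set d := u - covarianceOperator μ (L (L.adjoint u)) with hd
    -- Perturbing the dual variable along the defect `d` leaves `t‖d‖² - t²⟪K d, d⟫/2 ≤ 0` for all
    -- `t`, which forces `d = 0`.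
    have h1 := hineq (L (L.adjoint u) + t • d) (L.adjoint u)
    have h2 : ‖d‖ ^ 2 = ⟪d, u⟫ - ⟪covarianceOperator μ (L (L.adjoint u)), d⟫ := by
      rw [real_inner_comm d, ← inner_sub_right, ← hd, real_inner_self_eq_norm_sq]
    rw [h2]
    simp only [map_add, map_smul, inner_add_left, inner_add_right, real_inner_smul_left,
      real_inner_smul_right, hq, inner_covarianceOperator_comm d, hinner,
      real_inner_self_eq_norm_sq] at h1
    linarith
  · have h1 := hineq (L (L.adjoint u)) c
    rw [hq, hinner, real_inner_self_eq_norm_sq, hΦu] at h1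
    linarith

theorem exists_forall_add_norm_sq_le {H : Type*} [NormedAddCommGroup H] [InnerProductSpace ℝ H]
    [FiniteDimensional ℝ H] {g : H → ℝ} (hg : Continuous g) (hg0 : ∀ c, 0 ≤ g c) :
    ∃ c₀, ∀ c, g c₀ + ‖c₀‖ ^ 2 / 2 ≤ g c + ‖c‖ ^ 2 / 2 := by
  refine Continuous.exists_forall_le (f := fun c => g c + ‖c‖ ^ 2 / 2) (by fun_prop) ?_
  have : Tendsto (fun c : H => ‖c‖ ^ 2 / 2) (cocompact H) atTop :=
    (((tendsto_pow_atTop two_ne_zero).comp (tendsto_norm_cocompact_atTop (E := H)))).atTop_div_const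
      two_pos
  exact tendsto_atTop_mono (fun c => by linarith [hg0 c]) this

end Tilted

/-! ### Least-norm points of a fibre are conditional modes. -/

section ConditionalMode

variable {X : Type*} [NormedAddCommGroup X] [InnerProductSpace ℝ X] [CompleteSpace X]
  [SecondCountableTopology X] [MeasurableSpace X] [BorelSpace X] {μ : Measure X} [IsGaussian μ]

/-- A point of least Cameron-Martin norm in a fibre of a continuous function of finitely many
functionals is a conditional mode. -/
theorem isConditionalMode_of_forall_norm_le {H W Y : Type*} [NormedAddCommGroup H]
    [InnerProductSpace ℝ H] [FiniteDimensional ℝ H] [NormedAddCommGroup W] [NormedSpace ℝ W]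
    [MetricSpace Y] [MeasurableSpace Y] [BorelSpace Y]
    (hμ : ∫ x, x ∂μ = 0) {L : H →L[ℝ] X}
    (hL : ∀ c, L.adjoint (covarianceOperator μ (L c)) = c) {P : X →L[ℝ] W} {F : W → Y}
    (hF : Continuous F)
    (hPL : ∀ᵐ w ∂μ, P w = P (covarianceOperator μ (L (L.adjoint w)))) {y : Y} {c₀ : H}
    (hy : F (P (covarianceOperator μ (L c₀))) = y)
    (hc₀ : ∀ c, F (P (covarianceOperator μ (L c))) = y → ‖c₀‖ ≤ ‖c‖) :
    IsConditionalMode μ (fun u => F (P u)) y (covarianceOperator μ (L c₀)) := by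
  have hq : ⟪covarianceOperator μ (L c₀), L c₀⟫ = ‖c₀‖ ^ 2 := by
    rw [← ContinuousLinearMap.adjoint_inner_left, hL, real_inner_self_eq_norm_sq]
  set u₀ := covarianceOperator μ (L c₀) with hu₀
  have hcont : Continuous fun u => F (P u) := hF.comp P.continuous
  have hlow := fun r => exp_mul_measure_ball_zero_le hμ (L c₀) r
  have hpos : ∀ r > 0, 0 < μ (Metric.ball u₀ r) := fun r hr =>
    (ENNReal.mul_pos (ENNReal.ofReal_pos.2 (Real.exp_pos _)).ne'
      (measure_ball_zero_pos hμ hr).ne').trans_le (hlow r)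
  refine ⟨(Measure.mem_support_iff_forall _).2 fun U hU => ?_, hy, ?_⟩
  · obtain ⟨V, hVU, hV, hyV⟩ := mem_nhds_iff.1 hU
    refine lt_of_lt_of_le ?_ (measure_mono hVU)
    rw [Measure.map_apply hcont.measurable hV.measurableSet]
    obtain ⟨r, hr, hsub⟩ := Metric.isOpen_iff.1 (hV.preimage hcont) u₀ (by simpa [hy] using hyV)
    exact (hpos r hr).trans_le (measure_mono hsub)
  have hle (r : ℝ) : μ (Metric.ball u₀ r) ≤
      ⨆ v ∈ (fun u => F (P u)) ⁻¹' {y}, μ (Metric.ball v r) :=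
    le_iSup₂ (f := fun v (_ : v ∈ (fun u => F (P u)) ⁻¹' {y}) => μ (Metric.ball v r)) u₀ hy
  refine tendsto_div_nhds_one (Eventually.of_forall hle) ?_ (Eventually.of_forall fun r =>
    ((iSup₂_le fun v _ => prob_le_one).trans_lt ENNReal.one_lt_top).ne) fun η hη => ?_
  · filter_upwards [self_mem_nhdsWithin] with r hr using ((hpos r hr).trans_le (hle r)).ne'
  -- Coordinates with norm below the minimum by a margin form a compact set whose image under `P K
  -- L` misses the closed fibre of `F`, hence stays at distance at least some `δ` from it.
  set S : Set H := {c | ‖c‖ ^ 2 / 2 ≤ ‖c₀‖ ^ 2 / 2 - η / 2} with hS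
  have hScpt : IsCompact S := by
    refine Metric.isCompact_of_isClosed_isBounded (isClosed_le (by fun_prop) (by fun_prop))
      ((Metric.isBounded_closedBall (x := 0) (r := ‖c₀‖)).subset fun c hc => ?_)
    rw [mem_closedBall_zero_iff]
    refine abs_le_of_sq_le_sq' ?_ (norm_nonneg _) |>.2
    have : ‖c‖ ^ 2 / 2 ≤ ‖c₀‖ ^ 2 / 2 - η / 2 := hc
    linarith
  have himg : IsCompact ((fun c => P (covarianceOperator μ (L c))) '' S) :=
    hScpt.image (by fun_prop)
  obtain ⟨δ, hδ, hthick⟩ := himg.exists_thickening_subset_open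
    (isClosed_singleton.preimage hF : IsClosed (F ⁻¹' {y})).isOpen_compl (by
      rintro _ ⟨c, hc, rfl⟩ hcy
      have h1 := hc₀ c hcy
      have h2 : ‖c‖ ^ 2 / 2 ≤ ‖c₀‖ ^ 2 / 2 - η / 2 := hc
      have h3 := pow_le_pow_left₀ (norm_nonneg _) h1 2
      linarith)
  have hsmall : ∀ᶠ r : ℝ in 𝓝[>] 0, r * (‖c₀‖ ^ 2 / 2 + 2 * ‖L‖ ^ 2 + ‖L c₀‖) < η / 2 := by
    have : Continuous fun r : ℝ => r * (‖c₀‖ ^ 2 / 2 + 2 * ‖L‖ ^ 2 + ‖L c₀‖) := by fun_prop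
    have := (this.tendsto 0).mono_left (nhdsWithin_le_nhds (s := Set.Ioi 0))
    rw [zero_mul] at this
    exact this.eventually (gt_mem_nhds (half_pos hη))
  have hsmallP : ∀ᶠ r : ℝ in 𝓝[>] 0, ‖P‖ * r < δ := by
    have : Continuous fun r : ℝ => ‖P‖ * r := by fun_prop
    have := (this.tendsto 0).mono_left (nhdsWithin_le_nhds (s := Set.Ioi 0))
    rw [mul_zero] at this
    exact this.eventually (gt_mem_nhds hδ)
  filter_upwards [hsmall, hsmallP, Ioo_mem_nhdsGT (zero_lt_one' ℝ)] with r h1 h2 h3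
  refine iSup₂_le fun v hv => ?_
  rcases eq_or_ne (μ (Metric.ball v r)) 0 with h0 | h0
  · rw [h0]
    exact zero_le
  -- The centre `v` itself may violate the a.s. identity, but a ball of positive measure contains a
  -- point `w` satisfying it. As `P w` is `δ`-close to `P v`, the norm of `L* w` is nearly minimal.
  obtain ⟨w, hwv, hw⟩ : ∃ w ∈ Metric.ball v r, P w = P (covarianceOperator μ (L (L.adjoint w))) := by
    by_contra! hcon
    exact h0 (measure_mono_null (fun w hw => hcon w hw) (ae_iff.1 hPL))
  have hwS : L.adjoint w ∉ S := fun hmem => by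
    refine hthick (Metric.mem_thickening_iff.2 ⟨_, Set.mem_image_of_mem _ hmem, ?_⟩) hv
    rw [← hw, dist_comm, dist_eq_norm, ← map_sub]
    exact ((P.le_opNorm _).trans (mul_le_mul_of_nonneg_left (mem_ball_iff_norm.1 hwv).le
      (norm_nonneg _))).trans_lt h2
  have hwS' : ‖c₀‖ ^ 2 / 2 - η / 2 < ‖L.adjoint w‖ ^ 2 / 2 := not_le.1 hwS
  refine (measure_ball_le_of_mem_ball hμ hL hwv).trans ?_
  calc _ ≤ ENNReal.ofReal (Real.exp η) *
      (ENNReal.ofReal (Real.exp (-⟪u₀, L c₀⟫ / 2 - r * ‖L c₀‖)) * μ (Metric.ball 0 r)) := by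
        rw [← mul_assoc, ← ENNReal.ofReal_mul (Real.exp_pos _).le, ← Real.exp_add]
        refine mul_le_mul_left (ENNReal.ofReal_le_ofReal (Real.exp_le_exp.2 ?_)) _
        rw [hq]
        nlinarith [mul_le_mul_of_nonneg_left hwS'.le (by linarith [h3.2] : 0 ≤ 1 - r),
          mul_nonneg h3.1.le (sq_nonneg (‖L.adjoint w‖ - 2 * ‖L‖)), mul_nonneg h3.1.le hη.le]
    _ ≤ _ := by
        gcongr
        exact hlow r

end ConditionalMode

/-! ### Reduction to finitely many coordinates. -/

/-- Finitely many functionals only see a finite-dimensional space of Cameron-Martin directions. -/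
theorem exists_orthonormal_parametrisation {X : Type*} [NormedAddCommGroup X]
    [InnerProductSpace ℝ X] [CompleteSpace X] [SecondCountableTopology X] [MeasurableSpace X]
    [BorelSpace X] {μ : Measure X} [IsGaussian μ] {S : X →L[ℝ] X} (hS : S.IsPositive)
    (hSK : S ∘L S = covarianceOperator μ) {N : ℕ} (φ : Fin N → StrongDual ℝ X) :
    ∃ (k : ℕ) (L : EuclideanSpace ℝ (Fin k) →L[ℝ] X),
      (∀ c, L.adjoint (covarianceOperator μ (L c)) = c) ∧
      (∀ᵐ w ∂μ, ∀ i, φ i w = φ i (covarianceOperator μ (L (L.adjoint w)))) ∧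
      ∀ x, ∃ c, ∀ i, φ i (covarianceOperator μ (L c)) = φ i (S x) := by
  have hSs (x z : X) : ⟪S x, z⟫ = ⟪x, S z⟫ := hS.isSymmetric x z
  have hK (x : X) : covarianceOperator μ x = S (S x) := by rw [← hSK]; rfl
  set ψ : Fin N → X := fun i => (InnerProductSpace.toDual ℝ X).symm (φ i) with hψdef
  have hψ (i : Fin N) (x : X) : φ i x = ⟪ψ i, x⟫ := by
    simp [hψdef]
  set V : Submodule ℝ X := (Submodule.span ℝ (Set.range ψ)).map (S : X →ₗ[ℝ] X) with hV
  have : FiniteDimensional ℝ (Submodule.span ℝ (Set.range ψ)) :=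
    FiniteDimensional.span_of_finite ℝ (Set.finite_range ψ)
  have hVf : FiniteDimensional ℝ V := by rw [hV]; infer_instance
  set b := stdOrthonormalBasis ℝ V with hb
  have hmem (j) : ∃ a : X, S a = (b j : X) := by
    obtain ⟨a, -, ha⟩ := (b j).2
    exact ⟨a, ha⟩
  choose a ha using hmem
  set U : EuclideanSpace ℝ (Fin (Module.finrank ℝ V)) →ₗᵢ[ℝ] X :=
    V.subtypeₗᵢ.comp b.repr.symm.toLinearIsometry with hU
  set L : EuclideanSpace ℝ (Fin (Module.finrank ℝ V)) →L[ℝ] X :=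
    LinearMap.toContinuousLinearMap
      (Fintype.linearCombination ℝ a ∘ₗ (WithLp.linearEquiv 2 ℝ _).toLinearMap) with hLdef
  have hSL (c) : S (L c) = U c := by
    have h1 : L c = ∑ j, c j • a j := by simp [hLdef, Fintype.linearCombination_apply]
    have h2 : b.repr.symm c = ∑ j, c j • b j := (b.sum_repr_symm c).symm
    have h3 : U c = (b.repr.symm c : X) := rfl
    rw [h1, h3, h2, map_sum]
    simp [ha]
  -- Since `S L = U` is an isometry onto `V`, one gets `L* K L = U* U = 1`, and `U U*` fixes each `S
  -- (ψ i)`.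
  have hadj (x : X) : L.adjoint (S x) = U.toContinuousLinearMap.adjoint x := by
    refine ext_inner_left ℝ fun c => ?_
    rw [ContinuousLinearMap.adjoint_inner_right, ContinuousLinearMap.adjoint_inner_right, ← hSs,
      hSL]
    rfl
  have hUU (c) : U.toContinuousLinearMap.adjoint (U c) = c := by
    refine ext_inner_left ℝ fun d => ?_
    rw [ContinuousLinearMap.adjoint_inner_right]
    exact U.inner_map_map d c
  have hUS (i : Fin N) : U (U.toContinuousLinearMap.adjoint (S (ψ i))) = S (ψ i) := by
    have hi : S (ψ i) ∈ V := Submodule.mem_map_of_mem (Submodule.subset_span ⟨i, rfl⟩)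
    have : U (b.repr ⟨S (ψ i), hi⟩) = S (ψ i) := by simp [hU]
    rw [← this, hUU]
  have hLK (c) : L.adjoint (covarianceOperator μ (L c)) = c := by
    rw [hK, hSL, hadj, hUU]
  refine ⟨_, L, hLK, ?_, fun x => ⟨U.toContinuousLinearMap.adjoint x, fun i => ?_⟩⟩
  · rw [ae_all_iff]
    intro i
    -- A vector killed by `S` defines a functional of zero variance, which vanishes a.s.
    have h0 : S (ψ i - L (L.adjoint (covarianceOperator μ (ψ i)))) = 0 := by
      rw [map_sub, hSL, hK, hadj, hUS, sub_self]
    have h1 : ⟪covarianceOperator μ (ψ i - L (L.adjoint (covarianceOperator μ (ψ i)))),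
        ψ i - L (L.adjoint (covarianceOperator μ (ψ i)))⟫ = 0 := by
      rw [hK, h0, map_zero, inner_zero_left]
    filter_upwards [ae_inner_eq_zero h1] with w hw
    rw [inner_sub_left, sub_eq_zero] at hw
    rw [hψ, hψ, hw, ← ContinuousLinearMap.adjoint_inner_right,
      ContinuousLinearMap.adjoint_inner_left, inner_covarianceOperator_comm, real_inner_comm]
  · rw [hψ, hψ, hK, hSL, ← hSs, ← hSs]
    have h1 : ⟪S (ψ i), U (U.toContinuousLinearMap.adjoint x)⟫ =
        ⟪U.toContinuousLinearMap.adjoint (S (ψ i)), U.toContinuousLinearMap.adjoint x⟫ :=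
      (ContinuousLinearMap.adjoint_inner_left U.toContinuousLinearMap _ _).symm
    rw [h1, ContinuousLinearMap.adjoint_inner_right]
    exact congrArg (⟪·, x⟫) (hUS i)

theorem LipschitzOnBalls.continuous {N M : ℕ}
    {F : EuclideanSpace ℝ (Fin N) → EuclideanSpace ℝ (Fin M)} (hF : LipschitzOnBalls F) :
    Continuous F := by
  refine continuous_iff_continuousAt.2 fun x => ?_
  obtain ⟨K, hK⟩ := hF (‖x‖ + 1) (by positivity)
  exact hK.continuousOn.continuousAt (Metric.isOpen_ball.mem_nhds (by simp))

end GaussianModes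

/-! ### Existence of MAP estimators and the limit `β → 0`. -/

open GaussianModes in
theorem mainTheorem4 {X : Type*} [NormedAddCommGroup X] [InnerProductSpace ℝ X] [CompleteSpace X]
    [TopologicalSpace.SeparableSpace X] [MeasurableSpace X] [BorelSpace X]
    (μ : Measure X) [IsGaussian μ] (hμ : ∫ x, x ∂μ = 0)
    {N M : ℕ} (F : EuclideanSpace ℝ (Fin N) → EuclideanSpace ℝ (Fin M))
    (hF : GaussianModes.LipschitzOnBalls F) (φ : Fin N → StrongDual ℝ X)
    (y : EuclideanSpace ℝ (Fin M))
    (hy : y ∈ GaussianModes.forwardMap F φ '' GaussianModes.cameronMartinSpace μ) :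
    (∀ β : ℝ, 0 < β →
      ∃ u : X, GaussianModes.IsMode
        (GaussianModes.posterior μ (GaussianModes.forwardMap F φ) y β) u) ∧
    ∀ β : ℕ → ℝ, (∀ k, 0 < β k) → Tendsto β atTop (𝓝 0) →
      ∀ u : ℕ → X,
        (∀ k, GaussianModes.IsMode
          (GaussianModes.posterior μ (GaussianModes.forwardMap F φ) y (β k)) (u k)) →
        ∃ s : ℕ → ℕ, StrictMono s ∧ ∃ u₀ : X,
          Tendsto (fun n => u (s n)) atTop (𝓝 u₀) ∧
          GaussianModes.IsConditionalMode μ (GaussianModes.forwardMap F φ) y u₀ := by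
  have := UniformSpace.secondCountable_of_separable X
  have hFc := hF.continuous
  obtain ⟨h, ⟨S, hS, hSK, x, rfl⟩, hhy⟩ := hy
  obtain ⟨k, L, hL, hφL, hrange⟩ := exists_orthonormal_parametrisation hS hSK φ
  set P : X →L[ℝ] EuclideanSpace ℝ (Fin N) :=
    (PiLp.continuousLinearEquiv 2 ℝ (fun _ : Fin N => ℝ)).symm.toContinuousLinearMap ∘L
      ContinuousLinearMap.pi φ with hP
  have hG (u : X) : forwardMap F φ u = F (P u) := rfl
  have hGc : Continuous (forwardMap F φ) := hFc.comp P.continuous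
  have hPext {u v : X} (huv : ∀ i, φ i u = φ i v) : P u = P v := by
    ext i
    exact huv i
  have hPL : ∀ᵐ w ∂μ, P w = P (covarianceOperator μ (L (L.adjoint w))) := by
    filter_upwards [hφL] with w hw using hPext hw
  obtain ⟨c₁, hc₁⟩ := hrange x
  have hc₁y : forwardMap F φ (covarianceOperator μ (L c₁)) = y := by
    rw [← hhy, hG, hG, hPext hc₁]
  set Φ : ℝ → X → ℝ := fun β u => 1 / (2 * β ^ 2) * ‖forwardMap F φ u - y‖ ^ 2 with hΦdef
  have hΦ (β : ℝ) : Continuous (Φ β) := by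
    simp only [hΦdef]
    fun_prop
  have hΦ0 (β : ℝ) (u : X) : 0 ≤ Φ β u := by positivity
  have hΦL (β : ℝ) : ∀ᵐ w ∂μ, Φ β w = Φ β (covarianceOperator μ (L (L.adjoint w))) := by
    filter_upwards [hPL] with w hw
    simp only [hΦdef, hG, ← hw]
  have hpost (β : ℝ) : GaussianModes.posterior μ (forwardMap F φ) y β = μ.tilted fun u => -Φ β u := by
    simp only [GaussianModes.posterior, likelihood, Measure.tilted, hΦdef, neg_mul]
  refine ⟨fun β _ => ?_, fun β hβ hβ0 u hu => ?_⟩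
  · obtain ⟨c₀, hc₀⟩ := exists_forall_add_norm_sq_le
      (g := fun c => Φ β (covarianceOperator μ (L c))) ((hΦ β).comp (by fun_prop))
      (fun c => hΦ0 β _)
    rw [hpost]
    exact ⟨_, isMode_tilted_of_forall_le hμ hL (hΦL β) (hΦ β) (hΦ0 β) hc₀⟩
  have hmin (n : ℕ) := eq_and_forall_le_of_isMode_tilted hμ hL (hΦL (β n)) (hΦ (β n)) (hΦ0 (β n))
    (hpost (β n) ▸ hu n)
  -- Feasible competitors have zero misfit, so this bound does not depend on `β`.
  have hle (n : ℕ) {c} (hc : forwardMap F φ (covarianceOperator μ (L c)) = y) :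
      Φ (β n) (covarianceOperator μ (L (L.adjoint (u n)))) + ‖L.adjoint (u n)‖ ^ 2 / 2 ≤
        ‖c‖ ^ 2 / 2 := by
    have h1 := (hmin n).2 c
    have h2 : Φ (β n) (covarianceOperator μ (L c)) = 0 := by simp [hΦdef, hc]
    rwa [h2, zero_add] at h1
  have hnorm (n : ℕ) {c} (hc : forwardMap F φ (covarianceOperator μ (L c)) = y) :
      ‖L.adjoint (u n)‖ ≤ ‖c‖ :=
    (abs_le_of_sq_le_sq' (by
      linarith [hle n hc, hΦ0 (β n) (covarianceOperator μ (L (L.adjoint (u n))))])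
      (norm_nonneg _)).2
  obtain ⟨c₀, -, s, hs, hlim⟩ := tendsto_subseq_of_bounded
    (Metric.isBounded_closedBall (x := (0 : EuclideanSpace ℝ (Fin k))) (r := ‖c₁‖))
    (x := fun n => L.adjoint (u n)) fun n => mem_closedBall_zero_iff.2 (hnorm n hc₁y)
  have hE : Continuous fun c => covarianceOperator μ (L c) := by fun_prop
  have hlimE := (hE.tendsto c₀).comp hlim
  refine ⟨s, hs, covarianceOperator μ (L c₀), hlimE.congr fun n => (hmin (s n)).1.symm, ?_⟩
  have hsq (n : ℕ) : ‖forwardMap F φ (covarianceOperator μ (L (L.adjoint (u n)))) - y‖ ^ 2 ≤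
      β n ^ 2 * ‖c₁‖ ^ 2 := by
    have h1 := hle n hc₁y
    have h2 := pow_pos (hβ n) 2
    have h3 : Φ (β n) (covarianceOperator μ (L (L.adjoint (u n)))) ≤ ‖c₁‖ ^ 2 / 2 := by
      linarith [sq_nonneg ‖L.adjoint (u n)‖]
    simp only [hΦdef] at h3
    rw [one_div_mul_eq_div, div_le_iff₀ (by positivity)] at h3
    linarith
  have hy₀ : forwardMap F φ (covarianceOperator μ (L c₀)) = y := by
    have h1 : Tendsto (fun n => ‖forwardMap F φ (covarianceOperator μ (L (L.adjoint (u (s n))))) - y‖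
        ^ 2) atTop (𝓝 (‖forwardMap F φ (covarianceOperator μ (L c₀)) - y‖ ^ 2)) :=
      (((hGc.tendsto _).comp hlimE).sub_const y).norm.pow 2
    have h2 : Tendsto (fun n => β (s n) ^ 2 * ‖c₁‖ ^ 2) atTop (𝓝 0) := by
      simpa using ((hβ0.comp hs.tendsto_atTop).pow 2).mul_const (‖c₁‖ ^ 2)
    have h3 := le_of_tendsto_of_tendsto' h1 h2 fun n => hsq (s n)
    have h4 := pow_eq_zero_iff two_ne_zero |>.1 (le_antisymm h3 (sq_nonneg _))
    exact sub_eq_zero.1 (norm_eq_zero.1 h4)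
  exact isConditionalMode_of_forall_norm_le hμ hL hFc hPL hy₀ fun c hc =>
    le_of_tendsto' hlim.norm fun n => hnorm (s n) hc
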